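/- Rings are associative but need not have a unit, and all modules are left modules. A \emph{set of local units} for a ring $R$ is a set $E\subseteq R$ of pairwise commuting idempotents such that $R=\bigcup_{e\in E}eRe$. For $e,f\in E$ put $e\wedge f=ef$ and $e\vee f=e+f-ef$. An $R$-module $M$ is \emph{unitary} if $RM=M$, where $RM$ is the set of finite sums of elements $rm$ with $r\in R$, $m\in M$. Two rings with local units are \emph{Morita equivalent} if their categories of unitary modules (with all module homomorphisms as morphisms) are equivalent. Theorem. Let $R$ be a ring, let $E$ be a set of local units for $R$ such that $e\wedge f\in E$ and $e\vee f\in E$ for all $e,f\in E$, and let $S\subseteq R$ be a subring (not necessarily unital). Suppose that (1) $E\cap S$ is a set of local units for $S$; (2) $eSe=eRe$ for all $e\in E\cap S$; (3) for every $e\in E$ there are an index set $I$, a family $(e_i)_{i\in I}$ of elements of $E\cap S$, and a surjective $R$-module homomorphism $\bigoplus_{i\in I}Re_i\to Re$. Then $S$ and $R$ are Morita equivalent. -/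

import Mathlib

open CategoryTheory
open scoped DirectSum

universe u u₁ u₂ v w

/-- A left module over a ring `R` which need not have a unit: an abelian group with an
associative, biadditive action of `R`. -/
class NonUnitalModule (R : Type u) (M : Type v) [NonUnitalRing R] [AddCommGroup M]
    extends SemigroupAction R M, DistribSMul R M where
  add_smul : ∀ (r s : R) (m : M), (r + s) • m = r • m + s • m

/-- A homomorphism of left modules over a ring which need not have a unit. -/
@[ext]
structure NonUnitalModuleHom (R : Type u) (M : Type v) (N : Type w) [NonUnitalRing R]
    [AddCommGroup M] [NonUnitalModule R M] [AddCommGroup N] [NonUnitalModule R N] where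
  toAddMonoidHom : M →+ N
  map_smul : ∀ (r : R) (m : M), toAddMonoidHom (r • m) = r • toAddMonoidHom m

namespace NonUnitalModuleHom

/-- The identity homomorphism. -/
def id (R : Type u) (M : Type v) [NonUnitalRing R] [AddCommGroup M] [NonUnitalModule R M] :
    NonUnitalModuleHom R M M where
  toAddMonoidHom := AddMonoidHom.id M
  map_smul _ _ := rfl

/-- The composite of two homomorphisms. -/
def comp {R : Type u} {M : Type v} {N : Type w} {P : Type u₁} [NonUnitalRing R]
    [AddCommGroup M] [NonUnitalModule R M] [AddCommGroup N] [NonUnitalModule R N]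
    [AddCommGroup P] [NonUnitalModule R P]
    (g : NonUnitalModuleHom R N P) (f : NonUnitalModuleHom R M N) :
    NonUnitalModuleHom R M P where
  toAddMonoidHom := g.toAddMonoidHom.comp f.toAddMonoidHom
  map_smul r m := by simp [f.map_smul, g.map_smul]

end NonUnitalModuleHom

/-- The module `M` is unitary if `RM = M`, where `RM` is the set of finite sums of elements
`r • m`, that is, the additive subgroup generated by them. -/
def IsUnitaryModule (R : Type u) (M : Type v) [NonUnitalRing R] [AddCommGroup M]
    [NonUnitalModule R M] : Prop :=
  AddSubgroup.closure {x : M | ∃ (r : R) (m : M), x = r • m} = ⊤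

/-- The category of unitary left `R`-modules (with carrier in the universe `v`). -/
structure UnitaryModuleCat (R : Type u) [NonUnitalRing R] where
  carrier : Type v
  [isAddCommGroup : AddCommGroup carrier]
  [isModule : NonUnitalModule R carrier]
  isUnitary : IsUnitaryModule R carrier

attribute [instance] UnitaryModuleCat.isAddCommGroup UnitaryModuleCat.isModule

instance UnitaryModuleCat.category (R : Type u) [NonUnitalRing R] :
    Category.{v} (UnitaryModuleCat.{u, v} R) where
  Hom M N := NonUnitalModuleHom R M.carrier N.carrier
  id M := NonUnitalModuleHom.id R M.carrier
  comp f g := g.comp f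

/-- Morita equivalence: the categories of unitary left modules are equivalent. The carriers of
the modules live in a universe which contains both rings and is otherwise arbitrary. -/
def MoritaEquivalentRings (R : Type u₁) (S : Type u₂) [NonUnitalRing R] [NonUnitalRing S] : Prop :=
  Nonempty (UnitaryModuleCat.{u₁, max u₁ u₂ v} R ≌ UnitaryModuleCat.{u₂, max u₁ u₂ v} S)

/-- The set `e T e = {e t e | t ∈ T}`. -/
def corner {R : Type u} [NonUnitalRing R] (e : R) (T : Set R) : Set R :=
  (fun t => e * t * e) '' T

/-- `E` is a set of local units for `R`: a set of commuting idempotents such that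
`R` is the union of the sets `e R e`, `e ∈ E`. -/
structure IsLocalUnits {R : Type u} [NonUnitalRing R] (E : Set R) : Prop where
  idem : ∀ e ∈ E, IsIdempotentElem e
  comm : ∀ e ∈ E, ∀ f ∈ E, Commute e f
  iUnion_corner : ⋃ e ∈ E, corner e (Set.univ : Set R) = Set.univ

/-- `R e = {r e | r ∈ R}`, as an additive subgroup of `R`. -/
def leftMultiples {R : Type u} [NonUnitalRing R] (e : R) : AddSubgroup R :=
  (AddMonoidHom.mulRight e).range

/-- `R e` is a left `R`-module under the multiplication of `R`. -/
instance leftMultiples.module {R : Type u} [NonUnitalRing R] (e : R) :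
    NonUnitalModule R (leftMultiples e) where
  smul r x := ⟨r * x.1, by
    obtain ⟨y, hy⟩ := x.2
    exact ⟨r * y, by rw [← hy]; exact mul_assoc r y e⟩⟩
  mul_smul r s x := Subtype.ext (mul_assoc r s x.1)
  smul_zero r := Subtype.ext (mul_zero r)
  smul_add r x y := Subtype.ext (mul_add r x.1 y.1)
  add_smul r s x := Subtype.ext (add_mul r s x.1)

/-- The direct sum of a family of modules, with the componentwise action. -/
instance DirectSum.nonUnitalModule {R : Type u} [NonUnitalRing R] {I : Type w} (M : I → Type v)
    [∀ i, AddCommGroup (M i)] [∀ i, NonUnitalModule R (M i)] :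
    NonUnitalModule R (⨁ i, M i) where
  smul r x := DFinsupp.mapRange (fun _ m => r • m) (fun _ => smul_zero r) x
  mul_smul r s x := DFinsupp.ext fun i => mul_smul r s (x i)
  smul_zero r := DFinsupp.ext fun _ => smul_zero r
  smul_add r x y := DFinsupp.ext fun i => smul_add r (x i) (y i)
  add_smul r s x := DFinsupp.ext fun i => NonUnitalModule.add_smul r s (x i)

/-!
Write `F = E ∩ S`. The hypotheses enter through two facts: `S R S ⊆ S`, because two elements of `S`
lie in a common corner `f S f` with `f ∈ F` and `f R f = f S f`; and `R S R = R`, because the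
surjection `⨁ R eᵢ → R e` exhibits `e` as a finite sum of elements `x eᵢ y`.

The equivalence is the functor `M ↦ S M` from unitary `R`-modules to unitary `S`-modules. As `F` is
directed, `S M` is the set of the elements fixed by some `f ∈ F`, and this is how `sPart` defines it.

* The functor is faithful because `R S R = R` makes `S M` generate `M` (`IsFullCorner.eq_top`).
* It is full: given `g : S M → S M'`, the pairs `(m, m')` such that `g (s b m) = s b m'` for all
  `s ∈ S` and `b ∈ R` form an `R`-stable subgroup of `M × M'`. It is single-valued because an element
  `x` with `S R x = 0` vanishes (`IsFullCorner.eq_zero`), and its domain is all of `M` because it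
  contains `S M`. So it is the graph of a homomorphism that extends `g`.
* It is essentially surjective: a unitary `S`-module `N` is `S M` for `M` the image of the natural
  map `R S ⊗ N → Hom (S R, N)`, `r t ⊗ n ↦ (s b ↦ (s b r t) n)`. `Induced` realises it inside the
  functions of the pair `(s, b)`. Working with an image in a space of functions, instead of with the
  tensor product over `S`, reduces every identity in `M` to one in `N`.
-/

/-! ### Modules over rings with local units -/

namespace NonUnitalModule

variable {R : Type u} {M : Type v} [NonUnitalRing R] [AddCommGroup M] [NonUnitalModule R M]

/-- The additive map `r ↦ r m` of a fixed element `m`. -/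
def smulHom (m : M) : R →+ M :=
  AddMonoidHom.mk' (fun r => r • m) fun r s => add_smul r s m

theorem sub_smul (r s : R) (m : M) : (r - s) • m = r • m - s • m := (smulHom m).map_sub r s

end NonUnitalModule

theorem isUnitaryModule_of_forall_exists_smul_eq {R : Type u} {M : Type v} [NonUnitalRing R]
    [AddCommGroup M] [NonUnitalModule R M] (h : ∀ m : M, ∃ r : R, r • m = m) :
    IsUnitaryModule R M := by
  refine (AddSubgroup.eq_top_iff' _).2 fun m => AddSubgroup.subset_closure ?_
  obtain ⟨r, hr⟩ := h m
  exact ⟨r, m, hr.symm⟩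

namespace IsLocalUnits

variable {R : Type u} [NonUnitalRing R] {E : Set R}

theorem exists_corner (hE : IsLocalUnits E) (r : R) : ∃ e ∈ E, e * r = r ∧ r * e = r := by
  have h : r ∈ ⋃ e ∈ E, corner e (Set.univ : Set R) := by
    rw [hE.iUnion_corner]
    trivial
  simp only [Set.mem_iUnion] at h
  obtain ⟨e, he, t, -, rfl⟩ := h
  have hi : e * e = e := hE.idem e he
  refine ⟨e, he, ?_, ?_⟩
  · simp only [← mul_assoc, hi]
  · simp only [mul_assoc, hi]

variable {M : Type v} [AddCommGroup M] [NonUnitalModule R M]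

theorem join_smul_left (hE : IsLocalUnits E) {e f : R} (he : e ∈ E) (hf : f ∈ E) {m : M}
    (hm : e • m = m) : (e + f - e * f) • m = m := by
  rw [NonUnitalModule.sub_smul, NonUnitalModule.add_smul, (hE.comm e he f hf).eq, mul_smul, hm,
    add_sub_cancel_right]

theorem join_smul_right {e f : R} {m : M} (hm : f • m = m) : (e + f - e * f) • m = m := by
  rw [NonUnitalModule.sub_smul, NonUnitalModule.add_smul, mul_smul, hm, add_sub_cancel_left]

theorem exists_common_smul_eq (hE : IsLocalUnits E)
    (hj : ∀ e ∈ E, ∀ f ∈ E, e + f - e * f ∈ E) {m n : M}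
    (hm : ∃ e ∈ E, e • m = m) (hn : ∃ e ∈ E, e • n = n) :
    ∃ e ∈ E, e • m = m ∧ e • n = n := by
  obtain ⟨e, he, hm⟩ := hm
  obtain ⟨f, hf, hn⟩ := hn
  exact ⟨_, hj e he f hf, hE.join_smul_left he hf hm, join_smul_right hn⟩

theorem exists_smul_eq (hE : IsLocalUnits E) (hj : ∀ e ∈ E, ∀ f ∈ E, e + f - e * f ∈ E)
    (hM : IsUnitaryModule R M) (m : M) : ∃ e ∈ E, e • m = m := by
  have hm : m ∈ AddSubgroup.closure {x : M | ∃ (r : R) (m : M), x = r • m} := by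
    rw [show AddSubgroup.closure {x : M | ∃ (r : R) (m : M), x = r • m} = ⊤ from hM]
    trivial
  induction hm using AddSubgroup.closure_induction with
  | mem x hx =>
    obtain ⟨r, n, rfl⟩ := hx
    obtain ⟨e, he, her, -⟩ := hE.exists_corner r
    exact ⟨e, he, by rw [← mul_smul, her]⟩
  | zero =>
    obtain ⟨e, he, -⟩ := hE.exists_corner 0
    exact ⟨e, he, smul_zero e⟩
  | add x y _ _ hx hy =>
    obtain ⟨e, he, h, h'⟩ := hE.exists_common_smul_eq hj hx hy
    exact ⟨e, he, by rw [smul_add, h, h']⟩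
  | neg x _ hx =>
    obtain ⟨e, he, h⟩ := hx
    exact ⟨e, he, by rw [smul_neg, h]⟩

end IsLocalUnits

/-! ### Full corners -/

/-- A subring `S` of `R` that has local units in common with `R` and satisfies `S R S ⊆ S` and
`R S R = R`. -/
structure IsFullCorner {R : Type u} [NonUnitalRing R] (E : Set R) (S : NonUnitalSubring R) :
    Prop where
  units : IsLocalUnits E
  join : ∀ e ∈ E, ∀ f ∈ E, e + f - e * f ∈ E
  subunits : IsLocalUnits {s : S | (s : R) ∈ E}
  mul_mul_mem : ∀ (s : S) (b : R) (t : S), (s : R) * b * t ∈ S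
  full : ∀ r : R, r ∈ AddSubgroup.closure {x : R | ∃ (a : R) (s : S) (b : R), x = a * s * b}

namespace NonUnitalModuleHom

variable {R : Type u} {M : Type v} {N : Type w} [NonUnitalRing R]
  [AddCommGroup M] [NonUnitalModule R M] [AddCommGroup N] [NonUnitalModule R N]

/-- The image of a homomorphism from `⨁ R fᵢ` lies in the sum of the sets `R fᵢ R`, because such a
homomorphism is determined by the images of the elements `fᵢ = fᵢ fᵢ`. -/
theorem leftMultiples_directSum_mem_closure {I : Type v} {f : I → R}
    (hf : ∀ i, f i * f i = f i) {e : R}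
    (φ : NonUnitalModuleHom R (⨁ i, leftMultiples (f i)) (leftMultiples e))
    (x : ⨁ i, leftMultiples (f i)) :
    (φ.toAddMonoidHom x : R) ∈
      AddSubgroup.closure {x : R | ∃ (a : R) (i : I) (b : R), x = a * f i * b} := by
  classical
  induction x using DirectSum.induction_on with
  | zero => rw [map_zero]; exact zero_mem _
  | add x y hx hy => rw [map_add]; exact add_mem hx hy
  | of i y =>
    have hsmul (r : R) (z : leftMultiples (f i)) :
        DirectSum.of (fun i => leftMultiples (f i)) i (r • z) =
          r • DirectSum.of (fun i => leftMultiples (f i)) i z :=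
      (DFinsupp.mapRange_single (f := fun _ m => r • m) (hf := fun _ => smul_zero r)).symm
    have hy : y.1 * f i = y.1 := by
      obtain ⟨r, hr⟩ := y.2
      rw [← hr]
      exact (mul_assoc r (f i) (f i)).trans (congrArg (r * ·) (hf i))
    -- `y = y · fᵢ · fᵢ`, where the last factor is regarded as an element of `R fᵢ`
    let g : leftMultiples (f i) := ⟨f i, f i, hf i⟩
    have hyg : y = y.1 • f i • g :=
      Subtype.ext (show y.1 = y.1 * (f i * f i) by rw [hf i, hy])
    refine AddSubgroup.subset_closure
      ⟨y.1, i, (φ.toAddMonoidHom (DirectSum.of (fun i => leftMultiples (f i)) i g)).1, ?_⟩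
    conv_lhs => rw [hyg, hsmul, hsmul, φ.map_smul, φ.map_smul]
    exact (mul_assoc _ _ _).symm

end NonUnitalModuleHom

theorem IsFullCorner.of_corner_eq {R : Type u} [NonUnitalRing R] (S : NonUnitalSubring R)
    (E : Set R) (hE : IsLocalUnits E) (hjoin : ∀ e ∈ E, ∀ f ∈ E, e + f - e * f ∈ E)
    (h₁ : IsLocalUnits {s : S | (s : R) ∈ E})
    (h₂ : ∀ e ∈ E ∩ (S : Set R), corner e (S : Set R) = corner e Set.univ)
    (h₃ : ∀ e ∈ E, ∃ (I : Type w) (f : I → R), (∀ i, f i ∈ E ∩ (S : Set R)) ∧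
      ∃ φ : NonUnitalModuleHom R (⨁ i, leftMultiples (f i)) (leftMultiples e),
        Function.Surjective φ.toAddMonoidHom) :
    IsFullCorner E S where
  units := hE
  join := hjoin
  subunits := h₁
  mul_mul_mem s b t := by
    obtain ⟨e, he, hes, -⟩ := h₁.exists_corner s
    obtain ⟨f, hf, -, htf⟩ := h₁.exists_corner t
    replace hes : (e : R) * s = s := congrArg Subtype.val hes
    replace htf : (t : R) * f = t := congrArg Subtype.val htf
    let g : S := e + f - e * f
    have hg : (g : R) ∈ E := hjoin e he f hf
    have hgs : (g : R) * s = s := by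
      change ((e : R) + f - e * f) * s = s
      rw [(hE.comm e he f hf).eq, _root_.sub_mul, add_mul, mul_assoc, hes, add_sub_cancel_right]
    have htg : (t : R) * g = t := by
      change (t : R) * ((e : R) + f - e * f) = t
      rw [(hE.comm e he f hf).eq, _root_.mul_sub, mul_add, ← mul_assoc, htf, add_sub_cancel_left]
    have h : (s : R) * b * t ∈ corner (g : R) (S : Set R) := by
      rw [h₂ g ⟨hg, g.2⟩]
      refine ⟨s * b * t, trivial, ?_⟩
      change (g : R) * (s * b * t) * g = s * b * t
      rw [mul_assoc (s : R), ← mul_assoc (g : R), hgs, mul_assoc, mul_assoc b, htg]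
    obtain ⟨x, hx, hxe⟩ := h
    rw [← hxe]
    exact S.mul_mem (S.mul_mem g.2 hx) g.2
  full r := by
    obtain ⟨e, he, her, -⟩ := hE.exists_corner r
    obtain ⟨I, f, hf, φ, hφ⟩ := h₃ e he
    obtain ⟨x, hx⟩ := hφ ⟨e, e, hE.idem e he⟩
    have hmem := φ.leftMultiples_directSum_mem_closure (fun i => hE.idem _ (hf i).1) x
    rw [hx] at hmem
    rw [← her]
    -- right multiplication by `r` preserves the additive subgroup `R S R`
    suffices h : AddSubgroup.closure {x : R | ∃ (a : R) (i : I) (b : R), x = a * f i * b} ≤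
        (AddSubgroup.closure {x : R | ∃ (a : R) (s : S) (b : R), x = a * s * b}).comap
          (AddMonoidHom.mulRight r) from h hmem
    rw [AddSubgroup.closure_le]
    rintro _ ⟨a, i, b, rfl⟩
    exact AddSubgroup.subset_closure ⟨a, ⟨f i, (hf i).2⟩, b * r, mul_assoc _ _ _⟩

namespace IsFullCorner

variable {R : Type u} [NonUnitalRing R] {E : Set R} {S : NonUnitalSubring R}

theorem subjoin (h : IsFullCorner E S) :
    ∀ e ∈ {s : S | (s : R) ∈ E}, ∀ f ∈ {s : S | (s : R) ∈ E},
      e + f - e * f ∈ {s : S | (s : R) ∈ E} :=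
  fun e he f hf => h.join e he f hf

theorem exists_unit (h : IsFullCorner E S) {N : Type v} [AddCommGroup N] [NonUnitalModule S N]
    (hN : IsUnitaryModule S N) (n : N) : ∃ f : S, (f : R) ∈ E ∧ f • n = n :=
  IsLocalUnits.exists_smul_eq h.subunits h.subjoin hN n

/-- The product `s b t`, which lies in `S` as soon as `s` and `t` do. -/
def sandwich (h : IsFullCorner E S) (s : S) (b : R) (t : S) : S :=
  ⟨s * b * t, h.mul_mul_mem s b t⟩

/-- `S M` generates every unitary `R`-module `M`, because `M = R M` and `R = R S R`. -/
theorem eq_top (h : IsFullCorner E S) {M : Type v} [AddCommGroup M] [NonUnitalModule R M]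
    (hM : IsUnitaryModule R M) (K : AddSubgroup M) (hK : ∀ (r : R), ∀ m ∈ K, r • m ∈ K)
    (hS : ∀ (s : S) (m : M), (s : R) • m ∈ K) : K = ⊤ := by
  rw [eq_top_iff, ← show AddSubgroup.closure {x : M | ∃ (r : R) (m : M), x = r • m} = ⊤ from hM,
    AddSubgroup.closure_le]
  rintro _ ⟨r, m, rfl⟩
  suffices h' : AddSubgroup.closure {x : R | ∃ (a : R) (s : S) (b : R), x = a * s * b} ≤
      K.comap (NonUnitalModule.smulHom m) from h' (h.full r)
  rw [AddSubgroup.closure_le]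
  rintro _ ⟨a, s, b, rfl⟩
  change (a * s * b) • m ∈ K
  rw [mul_smul, mul_smul]
  exact hK _ _ (hS _ _)

/-- An element `m` of a unitary `R`-module with `S R m = 0` vanishes: `m ∈ R m = R S R m`. -/
theorem eq_zero (h : IsFullCorner E S) {M : Type v} [AddCommGroup M] [NonUnitalModule R M]
    (hM : IsUnitaryModule R M) {m : M} (hm : ∀ (s : S) (b : R), (s : R) • b • m = 0) :
    m = 0 := by
  obtain ⟨e, -, he⟩ := h.units.exists_smul_eq h.join hM m
  rw [← he]
  suffices h' : AddSubgroup.closure {x : R | ∃ (a : R) (s : S) (b : R), x = a * s * b} ≤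
      (NonUnitalModule.smulHom m).ker from h' (h.full e)
  rw [AddSubgroup.closure_le]
  rintro _ ⟨a, s, b, rfl⟩
  change (a * s * b) • m = 0
  rw [mul_smul, mul_smul, hm, smul_zero]

/-! ### The functor `M ↦ S M` -/

/-- The subgroup `S M` of an `R`-module `M`, described as the set of elements that are fixed by
some common local unit of `S` and `R`. -/
def sPart (h : IsFullCorner E S) (M : Type v) [AddCommGroup M] [NonUnitalModule R M] :
    AddSubgroup M where
  carrier := {m | ∃ f : S, (f : R) ∈ E ∧ (f : R) • m = m}
  zero_mem' := by
    obtain ⟨e, he, -⟩ := h.subunits.exists_corner 0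
    exact ⟨e, he, smul_zero _⟩
  add_mem' := by
    rintro x y ⟨e, he, hx⟩ ⟨f, hf, hy⟩
    refine ⟨e + f - e * f, h.join e he f hf, ?_⟩
    change ((e : R) + f - e * f) • (x + y) = x + y
    rw [smul_add, h.units.join_smul_left he hf hx, IsLocalUnits.join_smul_right hy]
  neg_mem' := by
    rintro x ⟨e, he, hx⟩
    exact ⟨e, he, by rw [smul_neg, hx]⟩

section sPart

variable (h : IsFullCorner E S) {M : Type v} [AddCommGroup M] [NonUnitalModule R M]
  {M' : Type v} [AddCommGroup M'] [NonUnitalModule R M']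

theorem smul_mem_sPart (s : S) (m : M) : (s : R) • m ∈ h.sPart M := by
  obtain ⟨f, hf, hfs, -⟩ := h.subunits.exists_corner s
  replace hfs : (f : R) * s = s := congrArg Subtype.val hfs
  exact ⟨f, hf, by rw [← mul_smul, hfs]⟩

instance sPartModule : NonUnitalModule S (h.sPart M) where
  smul s x := ⟨(s : R) • x.1, h.smul_mem_sPart s x.1⟩
  mul_smul s t x := Subtype.ext (mul_smul (s : R) (t : R) x.1)
  smul_zero s := Subtype.ext (smul_zero (s : R))
  smul_add s x y := Subtype.ext (smul_add (s : R) x.1 y.1)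
  add_smul s t x := Subtype.ext (NonUnitalModule.add_smul (s : R) (t : R) x.1)

theorem isUnitaryModule_sPart : IsUnitaryModule S (h.sPart M) :=
  isUnitaryModule_of_forall_exists_smul_eq fun ⟨_, f, _, hm⟩ => ⟨f, Subtype.ext hm⟩

/-- The restriction of a homomorphism `M → M'` to `S M → S M'`. -/
def sPartMap (φ : NonUnitalModuleHom R M M') :
    NonUnitalModuleHom S (h.sPart M) (h.sPart M') where
  toAddMonoidHom := (φ.toAddMonoidHom.comp (h.sPart M).subtype).codRestrict (h.sPart M') (by
    rintro ⟨m, f, hf, hm⟩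
    refine ⟨f, hf, ?_⟩
    change (f : R) • φ.toAddMonoidHom m = φ.toAddMonoidHom m
    rw [← φ.map_smul, hm])
  map_smul s m := Subtype.ext (φ.map_smul s m.1)

theorem sPartMap_injective (hM : IsUnitaryModule R M) :
    Function.Injective (h.sPartMap (M := M) (M' := M')) := by
  intro φ ψ hφψ
  have heq (m : h.sPart M) : φ.toAddMonoidHom m = ψ.toAddMonoidHom m :=
    congrArg (fun χ => ((χ.toAddMonoidHom m : h.sPart M') : M')) hφψ
  have htop := h.eq_top hM (φ.toAddMonoidHom.eqLocus ψ.toAddMonoidHom)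
    (fun r m (hm : φ.toAddMonoidHom m = ψ.toAddMonoidHom m) =>
      show φ.toAddMonoidHom (r • m) = ψ.toAddMonoidHom (r • m) by
        rw [φ.map_smul, ψ.map_smul, hm])
    (fun s m => heq ⟨_, h.smul_mem_sPart s m⟩)
  ext m
  exact (htop ▸ AddSubgroup.mem_top m : m ∈ φ.toAddMonoidHom.eqLocus ψ.toAddMonoidHom)

/-- The additive map `m ↦ s m` from `M` to `S M`. -/
def toSPart (s : S) : M →+ h.sPart M where
  toFun m := ⟨_, h.smul_mem_sPart s m⟩
  map_zero' := Subtype.ext (smul_zero (s : R))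
  map_add' m n := Subtype.ext (smul_add (s : R) m n)

/-- The graph of the extension of `g : S M → S M'` to a homomorphism `M → M'`. -/
def extensionGraph (g : NonUnitalModuleHom S (h.sPart M) (h.sPart M')) :
    AddSubgroup (M × M') where
  carrier := {p | ∀ (s : S) (b : R),
    (g.toAddMonoidHom (h.toSPart s (b • p.1)) : M') = (s : R) • b • p.2}
  zero_mem' s b := by
    simp only [Prod.fst_zero, Prod.snd_zero, map_zero, smul_zero, ZeroMemClass.coe_zero]
  add_mem' := by
    intro p q hp hq s b
    simp only [Prod.fst_add, Prod.snd_add, map_add, smul_add, AddSubgroup.coe_add, hp s b,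
      hq s b]
  neg_mem' := by
    intro p hp s b
    simp only [Prod.fst_neg, Prod.snd_neg, map_neg, smul_neg,
      AddSubgroup.coe_neg, hp s b]

variable {h} in
theorem smul_mem_extensionGraph {g : NonUnitalModuleHom S (h.sPart M) (h.sPart M')} (r : R)
    {p : M × M'} (hp : p ∈ h.extensionGraph g) : (r • p.1, r • p.2) ∈ h.extensionGraph g := by
  intro s b
  have := hp s (b * r)
  simpa only [mul_smul] using this

variable {h} in
theorem mem_extensionGraph_of_sPart (g : NonUnitalModuleHom S (h.sPart M) (h.sPart M'))
    (m : h.sPart M) : ((m : M), (g.toAddMonoidHom m : M')) ∈ h.extensionGraph g := by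
  intro s b
  obtain ⟨f, -, hm⟩ := m.2
  have hf : f • m = m := Subtype.ext hm
  -- both sides are the action of the element `s b f` of `S`
  have h₁ : h.toSPart s (b • (m : M)) = h.sandwich s b f • m := by
    refine Subtype.ext ?_
    change (s : R) • b • (m : M) = ((s : R) * b * f) • (m : M)
    rw [mul_smul, mul_smul, hm]
  have h₂ : (f : R) • (g.toAddMonoidHom m : M') = g.toAddMonoidHom m :=
    congrArg Subtype.val ((g.map_smul f m).symm.trans (congrArg g.toAddMonoidHom hf))
  change (g.toAddMonoidHom (h.toSPart s (b • (m : M))) : M') =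
    (s : R) • b • (g.toAddMonoidHom m : M')
  rw [h₁, g.map_smul]
  change ((s : R) * b * f) • (g.toAddMonoidHom m : M') = _
  rw [mul_smul, mul_smul, h₂]

variable {h} in
theorem extensionGraph_unique (hM' : IsUnitaryModule R M')
    {g : NonUnitalModuleHom S (h.sPart M) (h.sPart M')} {m : M} {x y : M'}
    (hx : (m, x) ∈ h.extensionGraph g) (hy : (m, y) ∈ h.extensionGraph g) : x = y := by
  rw [← sub_eq_zero]
  refine h.eq_zero hM' fun s b => ?_
  rw [sub_eq_add_neg, smul_add, smul_add, smul_neg, smul_neg,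
    ← hx s b, ← hy s b, add_neg_cancel]

variable {h} in
theorem exists_mem_extensionGraph (hM : IsUnitaryModule R M)
    (g : NonUnitalModuleHom S (h.sPart M) (h.sPart M')) (m : M) :
    ∃ m' : M', (m, m') ∈ h.extensionGraph g := by
  have htop := h.eq_top hM ((h.extensionGraph g).map (AddMonoidHom.fst M M'))
    (by
      rintro r _ ⟨p, hp, rfl⟩
      exact ⟨_, smul_mem_extensionGraph r hp, rfl⟩)
    (fun s m => ⟨_, mem_extensionGraph_of_sPart g ⟨_, h.smul_mem_sPart s m⟩, rfl⟩)
  obtain ⟨⟨_, m'⟩, hp, rfl⟩ :=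
    (htop ▸ AddSubgroup.mem_top m : m ∈ (h.extensionGraph g).map (AddMonoidHom.fst M M'))
  exact ⟨m', hp⟩

theorem sPartMap_surjective (hM : IsUnitaryModule R M) (hM' : IsUnitaryModule R M') :
    Function.Surjective (h.sPartMap (M := M) (M' := M')) := by
  intro g
  choose f hf using exists_mem_extensionGraph hM g
  let φ : NonUnitalModuleHom R M M' :=
    { toAddMonoidHom := AddMonoidHom.mk' f fun m n =>
        extensionGraph_unique hM' (hf (m + n)) (add_mem (hf m) (hf n))
      map_smul := fun r m =>
        extensionGraph_unique hM' (hf (r • m)) (smul_mem_extensionGraph r (hf m)) }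
  refine ⟨φ, ?_⟩
  ext m
  exact extensionGraph_unique hM' (hf m) (mem_extensionGraph_of_sPart g m)

end sPart

/-- The functor `M ↦ S M` from unitary `R`-modules to unitary `S`-modules. -/
def sPartFunctor (h : IsFullCorner E S) : UnitaryModuleCat.{u, v} R ⥤ UnitaryModuleCat.{u, v} S where
  obj M := ⟨h.sPart M.carrier, h.isUnitaryModule_sPart⟩
  map {_ _} φ := h.sPartMap φ
  map_id _ := rfl
  map_comp _ _ := rfl

instance (h : IsFullCorner E S) : (sPartFunctor.{u, v} h).Faithful where
  map_injective {M _} := fun _ _ hφ => h.sPartMap_injective M.isUnitary hφ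

instance (h : IsFullCorner E S) : (sPartFunctor.{u, v} h).Full where
  map_surjective {M M'} := h.sPartMap_surjective M.isUnitary M'.isUnitary

/-! ### Induction of modules from `S` to `R` -/

section Induced

variable (h : IsFullCorner E S) {N : Type v} [AddCommGroup N] [NonUnitalModule S N]

/-- The function `(s, b) ↦ (s b r t) n` that represents the tensor `r t ⊗ n`. The pair `(s, b)`
stands for the element `s b` of `S R`. -/
def inducedTensor (r : R) (t : S) (n : N) : S → R → N :=
  fun s b => h.sandwich s (b * r) t • n

variable (N) in
/-- The `R`-module induced by the `S`-module `N`: the additive group generated by the tensors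
`r t ⊗ n`, which are regarded as functions of pairs `(s, b)`. -/
def Induced : AddSubgroup (S → R → N) :=
  AddSubgroup.closure {φ | ∃ (r : R) (t : S) (n : N), φ = h.inducedTensor r t n}

/-- Translation by `a`: the function `φ (s, b)` becomes `φ (s, b a)`. This is the action of `a` on the
induced module. -/
def translate (a : R) : (S → R → N) →+ (S → R → N) where
  toFun φ s b := φ s (b * a)
  map_zero' := rfl
  map_add' _ _ := rfl

theorem translate_inducedTensor (a r : R) (t : S) (n : N) :
    translate a (h.inducedTensor r t n) = h.inducedTensor (a * r) t n := by
  funext s b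
  change h.sandwich s (b * a * r) t • n = h.sandwich s (b * (a * r)) t • n
  rw [mul_assoc]

theorem inducedTensor_add_left (r r' : R) (t : S) (n : N) :
    h.inducedTensor (r + r') t n = h.inducedTensor r t n + h.inducedTensor r' t n := by
  funext s b
  change h.sandwich s (b * (r + r')) t • n =
    h.sandwich s (b * r) t • n + h.sandwich s (b * r') t • n
  rw [← NonUnitalModule.add_smul]
  refine congrArg (· • n) (Subtype.ext ?_)
  change (s : R) * (b * (r + r')) * t = (s : R) * (b * r) * t + (s : R) * (b * r') * t
  rw [mul_add, mul_add, add_mul]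

theorem translate_mem (a : R) {φ : S → R → N} (hφ : φ ∈ h.Induced N) :
    translate a φ ∈ h.Induced N := by
  suffices h' : h.Induced N ≤ (h.Induced N).comap (translate a) from h' hφ
  rw [Induced, AddSubgroup.closure_le]
  rintro _ ⟨r, t, n, rfl⟩
  exact AddSubgroup.subset_closure ⟨a * r, t, n, h.translate_inducedTensor a r t n⟩

theorem translate_add {φ : S → R → N} (hφ : φ ∈ h.Induced N) (a a' : R) :
    translate (a + a') φ = translate a φ + translate a' φ := by
  suffices h' : h.Induced N ≤ AddMonoidHom.eqLocus (translate (a + a'))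
      (translate a + translate a' : (S → R → N) →+ (S → R → N)) from h' hφ
  rw [Induced, AddSubgroup.closure_le]
  rintro _ ⟨r, t, n, rfl⟩
  change translate (a + a') (h.inducedTensor r t n) =
    translate a (h.inducedTensor r t n) + translate a' (h.inducedTensor r t n)
  simp only [translate_inducedTensor, add_mul, inducedTensor_add_left]

instance inducedModule : NonUnitalModule R (h.Induced N) where
  smul a φ := ⟨translate a φ.1, h.translate_mem a φ.2⟩
  mul_smul a a' φ := Subtype.ext <| funext fun s => funext fun b =>
    congrArg (φ.1 s) (mul_assoc b a a').symm
  smul_zero a := Subtype.ext (map_zero (translate a))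
  smul_add a φ ψ := Subtype.ext (map_add (translate a) φ.1 ψ.1)
  add_smul a a' φ := Subtype.ext (h.translate_add φ.2 a a')

theorem isUnitaryModule_induced : IsUnitaryModule R (h.Induced N) := by
  refine (AddSubgroup.eq_top_iff' _).2 ?_
  suffices h' : h.Induced N ≤ (AddSubgroup.closure
      {x : h.Induced N | ∃ (r : R) (m : h.Induced N), x = r • m}).map (h.Induced N).subtype by
    rintro φ
    obtain ⟨ψ, hψ, hψφ⟩ := h' φ.2
    rwa [← Subtype.ext hψφ]
  conv_lhs => rw [Induced]
  rw [AddSubgroup.closure_le]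
  rintro _ ⟨r, t, n, rfl⟩
  obtain ⟨e, -, her, -⟩ := h.units.exists_corner r
  refine ⟨⟨_, AddSubgroup.subset_closure ⟨r, t, n, rfl⟩⟩, AddSubgroup.subset_closure
    ⟨e, ⟨_, AddSubgroup.subset_closure ⟨r, t, n, rfl⟩⟩, Subtype.ext ?_⟩, rfl⟩
  exact (by rw [h.translate_inducedTensor, her] :
    h.inducedTensor r t n = translate e (h.inducedTensor r t n))

/-- The tensor `f ⊗ n` depends only on `n`, if `f` is a local unit with `f n = n`: two such local
units commute. -/
theorem inducedTensor_unit_eq {f f' : S} (hf : (f : R) ∈ E) (hf' : (f' : R) ∈ E) {n : N}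
    (hn : f • n = n) (hn' : f' • n = n) :
    h.inducedTensor (f : R) f n = h.inducedTensor (f' : R) f' n := by
  have key {f f' : S} (hf : (f : R) ∈ E) (hn' : f' • n = n) (s : S) (b : R) :
      h.inducedTensor (f : R) f n s b = h.sandwich s b (f * f') • n := by
    have : h.sandwich s (b * f) f • f' • n = h.sandwich s b (f * f') • n := by
      rw [← mul_smul]
      refine congrArg (· • n) (Subtype.ext ?_)
      change (s : R) * (b * f) * f * f' = s * b * (f * f')
      have hi : (f : R) * f = f := h.units.idem _ hf
      rw [← mul_assoc, mul_assoc _ (f : R) (f : R), hi, mul_assoc]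
    rwa [hn'] at this
  funext s b
  rw [key hf hn', key hf' hn, (h.subunits.comm f hf f' hf').eq]

theorem inducedTensor_mem_sPart {f : S} (hf : (f : R) ∈ E) (n : N) :
    (⟨h.inducedTensor (f : R) f n, AddSubgroup.subset_closure ⟨f, f, n, rfl⟩⟩ : h.Induced N) ∈
      h.sPart (h.Induced N) := by
  have hi : (f : R) * f = f := h.units.idem _ hf
  exact ⟨f, hf, Subtype.ext ((h.translate_inducedTensor (f : R) f f n).trans (by rw [hi]))⟩

/-- The map `n ↦ f ⊗ n` from `N` to the induced module, where `f` is a local unit that fixes `n`. -/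
noncomputable def toInduced (hN : IsUnitaryModule S N) (n : N) : h.sPart (h.Induced N) :=
  ⟨_, h.inducedTensor_mem_sPart (h.exists_unit hN n).choose_spec.1 n⟩

theorem coe_toInduced (hN : IsUnitaryModule S N) {f : S} (hf : (f : R) ∈ E) {n : N}
    (hn : f • n = n) : ((h.toInduced hN n : h.Induced N) : S → R → N) =
      h.inducedTensor (f : R) f n :=
  h.inducedTensor_unit_eq (h.exists_unit hN n).choose_spec.1 hf
    (h.exists_unit hN n).choose_spec.2 hn

/-- The isomorphism `N → S M` for the module `M` induced by `N`, as a homomorphism. -/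
noncomputable def toInducedHom (hN : IsUnitaryModule S N) :
    NonUnitalModuleHom S N (h.sPart (h.Induced N)) where
  toAddMonoidHom := AddMonoidHom.mk' (h.toInduced hN) fun m n => by
    obtain ⟨f, hf, hm, hn⟩ := h.subunits.exists_common_smul_eq h.subjoin
      (h.exists_unit hN m) (h.exists_unit hN n)
    refine Subtype.ext (Subtype.ext ?_)
    change ((h.toInduced hN (m + n) : h.Induced N) : S → R → N) =
      (h.toInduced hN m : h.Induced N) + (h.toInduced hN n : h.Induced N)
    rw [h.coe_toInduced hN hf hm, h.coe_toInduced hN hf hn,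
      h.coe_toInduced hN hf (show f • (m + n) = m + n by rw [smul_add, hm, hn])]
    funext s b
    exact smul_add (h.sandwich s (b * f) f) m n
  map_smul t n := by
    obtain ⟨f, hf, hfn, hftn⟩ := h.subunits.exists_common_smul_eq h.subjoin
      (h.exists_unit hN n) (h.exists_unit hN (t • n))
    refine Subtype.ext (Subtype.ext ?_)
    change ((h.toInduced hN (t • n) : h.Induced N) : S → R → N) =
      translate (t : R) (h.toInduced hN n : h.Induced N)
    rw [h.coe_toInduced hN hf hfn, h.coe_toInduced hN hf hftn, translate_inducedTensor]
    funext s b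
    have hi : (f : R) * f = f := h.units.idem _ hf
    change h.sandwich s (b * f) f • t • n = h.sandwich s (b * (t * f)) f • n
    -- both sides are equal to `(s b t) n`
    have h₁ : h.sandwich s (b * f) f = h.sandwich s b f :=
      Subtype.ext (show (s : R) * (b * f) * f = s * b * f by
        rw [mul_assoc, mul_assoc b, hi, mul_assoc])
    have h₂ : h.sandwich s (b * (t * f)) f • n = h.sandwich s b t • n := by
      have : h.sandwich s (b * (t * f)) f = h.sandwich s b t * f :=
        Subtype.ext (show (s : R) * (b * (t * f)) * f = s * b * t * f by
          simp only [mul_assoc, hi])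
      rw [this, mul_smul, hfn]
    -- for a local unit `g` with `g t = t`, `s b f t = s b f g t = s b g f t`, and `f` fixes `t n`
    have h₃ : h.sandwich s b f • t • n = h.sandwich s b t • n := by
      obtain ⟨g, hg, hgt, -⟩ := h.subunits.exists_corner t
      have hgt' : (g : R) * t = t := congrArg Subtype.val hgt
      have : h.sandwich s b f * t = h.sandwich s b g * (f * t) :=
        Subtype.ext (show (s : R) * b * f * t = s * b * g * (f * t) by
          rw [mul_assoc _ (g : R), ← mul_assoc (g : R), (h.units.comm _ hg _ hf).eq,
            mul_assoc (f : R), hgt', mul_assoc])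
      have hsgt : h.sandwich s b t • n = h.sandwich s b g • t • n := by
        rw [← mul_smul]
        exact congrArg (· • n) (Subtype.ext (show (s : R) * b * t = s * b * g * t by
          rw [mul_assoc _ (g : R), hgt']))
      rw [← mul_smul, this, mul_smul, mul_smul, hftn, hsgt]
    rw [h₁, h₂, h₃]

theorem toInducedHom_injective (hN : IsUnitaryModule S N) :
    Function.Injective (h.toInducedHom hN).toAddMonoidHom := by
  intro m n hmn
  obtain ⟨f, hf, hm, hn⟩ := h.subunits.exists_common_smul_eq h.subjoin
    (h.exists_unit hN m) (h.exists_unit hN n)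
  have hi : (f : R) * f = f := h.units.idem _ hf
  have key {n : N} (hn : f • n = n) :
      ((h.toInduced hN n : h.Induced N) : S → R → N) f f = n := by
    rw [h.coe_toInduced hN hf hn]
    have : h.sandwich f ((f : R) * f) f = f :=
      Subtype.ext (show (f : R) * (f * f) * f = f by rw [hi, hi, hi])
    exact (congrArg (· • n) this).trans hn
  rw [← key hm, ← key hn]
  exact congrArg (fun x : h.sPart (h.Induced N) => ((x : h.Induced N) : S → R → N) f f) hmn

theorem toInducedHom_surjective (hN : IsUnitaryModule S N) :
    Function.Surjective (h.toInducedHom hN).toAddMonoidHom := by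
  rintro ⟨φ, f, hf, hφ⟩
  have hi : (f : R) * f = f := h.units.idem _ hf
  -- translation by `f` maps the generator `r t ⊗ n` to the image of `(f r t) n`
  suffices h' : h.Induced N ≤ (((h.Induced N).subtype.comp (h.sPart (h.Induced N)).subtype).comp
      (h.toInducedHom hN).toAddMonoidHom).range.comap (translate (f : R)) by
    obtain ⟨n, hn⟩ := h' φ.2
    exact ⟨n, Subtype.ext (Subtype.ext (hn.trans (congrArg Subtype.val hφ)))⟩
  conv_lhs => rw [Induced]
  rw [AddSubgroup.closure_le]
  rintro _ ⟨r, t, n, rfl⟩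
  have hfix : f • h.sandwich f r t • n = h.sandwich f r t • n := by
    rw [← mul_smul]
    refine congrArg (· • n) (Subtype.ext ?_)
    change (f : R) * (f * r * t) = f * r * t
    rw [← mul_assoc, ← mul_assoc, hi]
  refine ⟨h.sandwich f r t • n, ?_⟩
  change ((h.toInduced hN (h.sandwich f r t • n) : h.Induced N) : S → R → N) = translate (f : R) _
  rw [h.coe_toInduced hN hf hfix, translate_inducedTensor]
  funext s b
  change h.sandwich s (b * f) f • h.sandwich f r t • n = h.sandwich s (b * (f * r)) t • n
  rw [← mul_smul]
  refine congrArg (· • n) (Subtype.ext ?_)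
  change (s : R) * (b * f) * f * (f * r * t) = s * (b * (f * r)) * t
  have hi' (x : R) : (f : R) * (f * x) = f * x := by rw [← mul_assoc, hi]
  simp only [mul_assoc, hi']

end Induced

/-- A bijective homomorphism of unitary modules is an isomorphism. -/
noncomputable def isoOfBijective {M N : UnitaryModuleCat.{u, v} R}
    (φ : NonUnitalModuleHom R M.carrier N.carrier) (hφ : Function.Bijective φ.toAddMonoidHom) :
    M ≅ N :=
  let e := AddEquiv.ofBijective φ.toAddMonoidHom hφ
  { hom := φ
    inv :=
      { toAddMonoidHom := e.symm.toAddMonoidHom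
        map_smul := fun r n => e.injective ((e.apply_symm_apply _).trans
          ((congrArg (r • ·) (e.apply_symm_apply n)).symm.trans (φ.map_smul r _).symm)) }
    hom_inv_id := NonUnitalModuleHom.ext (AddMonoidHom.ext e.symm_apply_apply)
    inv_hom_id := NonUnitalModuleHom.ext (AddMonoidHom.ext e.apply_symm_apply) }

instance (h : IsFullCorner E S) : (sPartFunctor.{u, max u v} h).EssSurj where
  mem_essImage N := ⟨⟨h.Induced N.carrier, h.isUnitaryModule_induced⟩,
    ⟨(isoOfBijective (h.toInducedHom N.isUnitary)
      ⟨h.toInducedHom_injective N.isUnitary, h.toInducedHom_surjective N.isUnitary⟩).symm⟩⟩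

theorem moritaEquivalentRings (h : IsFullCorner E S) : MoritaEquivalentRings.{u, u, v} S R :=
  have : (sPartFunctor.{u, max u v} h).IsEquivalence := {}
  ⟨(sPartFunctor.{u, max u v} h).asEquivalence.symm⟩

end IsFullCorner

theorem mainTheorem2 {R : Type u} [NonUnitalRing R] (S : NonUnitalSubring R) (E : Set R)
    (hE : IsLocalUnits E)
    (hmeet : ∀ e ∈ E, ∀ f ∈ E, e * f ∈ E)
    (hjoin : ∀ e ∈ E, ∀ f ∈ E, e + f - e * f ∈ E)
    (h₁ : IsLocalUnits {s : S | (s : R) ∈ E})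
    (h₂ : ∀ e ∈ E ∩ (S : Set R), corner e (S : Set R) = corner e Set.univ)
    (h₃ : ∀ e ∈ E, ∃ (I : Type w) (f : I → R), (∀ i, f i ∈ E ∩ (S : Set R)) ∧
      ∃ φ : NonUnitalModuleHom R (⨁ i, leftMultiples (f i)) (leftMultiples e),
        Function.Surjective φ.toAddMonoidHom) :
    MoritaEquivalentRings.{u, u, v} S R :=
  (IsFullCorner.of_corner_eq S E hE hjoin h₁ h₂ h₃).moritaEquivalentRings
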